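/- Let $T$ be a set of types. An oriented multi-virtual link diagram of type $T$ is a plane diagram of an oriented link in which every crossing is either classical (with over/under information) or virtual and labeled by an element of $T$. Two such diagrams are equivalent if one is obtained from the other by finitely many applications of planar isotopy, classical Reidemeister moves (with all orientations), and multi-virtual detour moves. In a multi-virtual detour move, a strand that meets the $m$ lower ends of an arbitrary tangle with $m$ lower and $n$ upper ends at virtual crossings of one and the same type $\alpha\in T$ is moved across this tangle, so that it meets the $n$ upper ends at virtual crossings of type $\alpha$ instead ($m,n\ge 0$); moreover, loops whose only crossing is virtual of type $\alpha$ may be added to or removed from a strand. A quandle is a set $Q$ with a binary operation $*$ such that every right translation $y\mapsto y*x$ is a bijection of $Q$, $(x*y)*z=(x*z)*(y*z)$, and $x*x=x$ for all $x,y,z\in Q$. An operator quandle $(Q,*,A_T)$ is a quandle with a family $A_T=(f_\alpha)_{\alpha\in T}$ of pairwise commuting (not necessarily distinct) automorphisms of $(Q,*)$. A coloring of an oriented multi-virtual link diagram $D$ by $(Q,*,A_T)$ assigns an element of $Q$ to each arc of $D$, where all strands are cut at virtual crossings and under-strands are cut at classical crossings, so that: * at a classical crossing whose over-strand has color $b$,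 if the part of the under-strand to the right of the oriented over-strand has color $a$, then the part to the left has color $a*b$; * at a virtual crossing of type $\alpha$, for each of its two strands, if the part to the right of the other (oriented) strand has color $a$, then the part to the left of the other strand has color $f_\alpha(a)$. Let $\mathrm{col}(D,Q,*,A_T)$ be the number (cardinality of the set) of colorings of $D$ by $(Q,*,A_T)$. **Theorem.** If $D_1$ and $D_2$ are equivalent oriented multi-virtual link diagrams of type $T$ and $(Q,*,A_T)$ is an operator quandle, then $\mathrm{col}(D_1,Q,*,A_T)=\mathrm{col}(D_2,Q,*,A_T)$. -/

import Mathlib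

/-!
Oriented multi-virtual link diagrams, their equivalence, and their colorings by operator quandles.

Diagrams are plane diagrams in general position with respect to a height function: reading from
bottom to top, every horizontal strip contains exactly one local minimum (cup), one local maximum
(cap), or one crossing, next to vertical strands.
-/

namespace MultiVirtual

universe u v

/-- The direction in which an oriented strand crosses a horizontal level. -/
inductive Dir : Type
  | up
  | down

/-- The opposite direction. -/
def Dir.rev : Dir → Dir
  | .up => .down
  | .down => .up

/-- The kind of a crossing between the strand `/`, which runs from the bottom left to the top right,
and the strand `\`, which runs from the bottom right to the top left: a classical crossing in which
`/` passes over `\`, a classical crossing in which `/` passes under `\`, or a virtual crossing of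
some type in `T`. -/
inductive Kind (T : Type u) : Type u
  | over
  | under
  | virt (α : T)

/-- The kind of the crossing after the roles of the strands `/` and `\` are exchanged. -/
def Kind.flip {T : Type u} : Kind T → Kind T
  | .over => .under
  | .under => .over
  | .virt α => .virt α

/-- The crossing is a classical one. -/
def Kind.IsClassical {T : Type u} : Kind T → Prop
  | .over => True
  | .under => True
  | .virt _ => False

/-- The elementary pieces of a diagram: a local minimum whose left end has direction `d` (and whose
right end has the opposite direction), a local maximum, and a crossing. -/
inductive Piece (T : Type u) : Type u
  | cup (d : Dir)
  | cap
  | cross (k : Kind T)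

/-- The number of strands at the bottom of a piece. -/
def Piece.numBottom {T : Type u} : Piece T → ℕ
  | .cup _ => 0
  | .cap => 2
  | .cross _ => 2

/-- The number of strands at the top of a piece. -/
def Piece.numTop {T : Type u} : Piece T → ℕ
  | .cup _ => 2
  | .cap => 0
  | .cross _ => 2

/-- A horizontal strip of a diagram: a single piece with exactly `pos` vertical strands to its left
(and any number of vertical strands to its right). -/
structure Slice (T : Type u) : Type u where
  pos : ℕ
  piece : Piece T

/-- `x.Joins s t`: the slice `x` fits between a lower level and an upper level at which the strands,
listed from left to right, have the directions `s` and `t`. -/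
inductive Slice.Joins {T : Type u} : Slice T → List Dir → List Dir → Prop
  | cup (l r : List Dir) (d : Dir) :
      Slice.Joins ⟨l.length, .cup d⟩ (l ++ r) (l ++ d :: d.rev :: r)
  | cap (l r : List Dir) (d : Dir) :
      Slice.Joins ⟨l.length, .cap⟩ (l ++ d :: d.rev :: r) (l ++ r)
  | cross (l r : List Dir) (k : Kind T) (d e : Dir) :
      Slice.Joins ⟨l.length, .cross k⟩ (l ++ d :: e :: r) (l ++ e :: d :: r)

/-- `Joins w s t`: the slices in `w`, stacked from bottom to top, form an oriented multi-virtual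
tangle diagram with lower boundary `s` and upper boundary `t`. -/
def Joins {T : Type u} : List (Slice T) → List Dir → List Dir → Prop
  | [], s, t => s = t
  | x :: w, s, t => ∃ m, x.Joins s m ∧ Joins w m t

/-- An oriented multi-virtual link diagram of type `T`: a tangle diagram without boundary. -/
structure Diagram (T : Type u) : Type u where
  word : List (Slice T)
  joins : Joins word [] []

/-- The tangle diagram `w` moved to the right, past `i` vertical strands. -/
def shift {T : Type u} (i : ℕ) (w : List (Slice T)) : List (Slice T) :=
  w.map fun x => ⟨i + x.pos, x.piece⟩

/-- A strand at position `i` passes to the right across the `m` strands that follow it, through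
virtual crossings of type `α`. -/
def passRight {T : Type u} (α : T) (i m : ℕ) : List (Slice T) :=
  (List.range m).map fun j => ⟨i + j, .cross (.virt α)⟩

/-- A strand at position `i + m` passes to the left across the `m` strands that precede it, through
virtual crossings of type `α`. -/
def passLeft {T : Type u} (α : T) (i m : ℕ) : List (Slice T) :=
  (passRight α i m).reverse

/-- Planar isotopy: two pieces that lie beside one another exchange heights, a local maximum and an
adjacent local minimum cancel, or a local extremum of one branch passes through a crossing. -/
inductive Isotopy {T : Type u} : List (Slice T) → List (Slice T) → Prop
  | exchange (i k : ℕ) (p q : Piece T) :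
      Isotopy [⟨i, p⟩, ⟨i + p.numTop + k, q⟩] [⟨i + p.numBottom + k, q⟩, ⟨i, p⟩]
  | zigzag (i : ℕ) (d : Dir) : Isotopy [⟨i + 1, .cup d⟩, ⟨i, .cap⟩] []
  | zagzig (i : ℕ) (d : Dir) : Isotopy [⟨i, .cup d⟩, ⟨i + 1, .cap⟩] []
  | slideCap (i : ℕ) (k : Kind T) :
      Isotopy [⟨i, .cross k⟩, ⟨i + 1, .cap⟩] [⟨i + 1, .cross k.flip⟩, ⟨i, .cap⟩]
  | slideCup (i : ℕ) (k : Kind T) (d : Dir) :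
      Isotopy [⟨i + 1, .cup d⟩, ⟨i, .cross k⟩] [⟨i, .cup d⟩, ⟨i + 1, .cross k.flip⟩]

/-- `Loop k w`: the tangle diagram `w` is a single strand with a loop (on its right or on its left)
whose only crossing has kind `k`. -/
inductive Loop {T : Type u} (k : Kind T) : List (Slice T) → Prop
  | right (i : ℕ) (d : Dir) : Loop k [⟨i + 1, .cup d⟩, ⟨i, .cross k⟩, ⟨i + 1, .cap⟩]
  | left (i : ℕ) (d : Dir) : Loop k [⟨i, .cup d⟩, ⟨i + 1, .cross k⟩, ⟨i, .cap⟩]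

/-- The classical Reidemeister moves, with all orientations of the strands. In the third move, `k₁`,
`k₂`, `k₃` are the crossings of the first and second, first and third, second and third strand; the
condition says that one strand is above the other two and one is below the other two. -/
inductive Reidemeister {T : Type u} : List (Slice T) → List (Slice T) → Prop
  | one (k : Kind T) (hk : k.IsClassical) (w : List (Slice T)) (hw : Loop k w) :
      Reidemeister w []
  | two (i : ℕ) (k : Kind T) (hk : k.IsClassical) :
      Reidemeister [⟨i, .cross k⟩, ⟨i, .cross k.flip⟩] []
  | three (i : ℕ) (k₁ k₂ k₃ : Kind T)
      (h₁ : k₁.IsClassical) (h₂ : k₂.IsClassical) (h₃ : k₃.IsClassical)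
      (h : k₂ = k₁ ∨ k₂ = k₃) :
      Reidemeister [⟨i, .cross k₁⟩, ⟨i + 1, .cross k₂⟩, ⟨i, .cross k₃⟩]
        [⟨i + 1, .cross k₃⟩, ⟨i, .cross k₂⟩, ⟨i + 1, .cross k₁⟩]

/-- The multi-virtual detour move: a strand that meets `m` strands at virtual crossings of the same
type `α` moves across an arbitrary tangle `w` with `m` lower and `n` upper ends, which results in
`n` virtual crossings of type `α`; and loops of type `α` may be added to a strand or removed. -/
inductive Detour {T : Type u} : List (Slice T) → List (Slice T) → Prop
  | right (α : T) (i : ℕ) (w : List (Slice T)) (s t : List Dir) (hw : Joins w s t) :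
      Detour (passRight α i s.length ++ shift i w) (shift (i + 1) w ++ passRight α i t.length)
  | left (α : T) (i : ℕ) (w : List (Slice T)) (s t : List Dir) (hw : Joins w s t) :
      Detour (passLeft α i s.length ++ shift (i + 1) w) (shift i w ++ passLeft α i t.length)
  | loop (α : T) (w : List (Slice T)) (hw : Loop (.virt α) w) : Detour w []

/-- `D₂` arises from `D₁` by replacing one part of the diagram in a single isotopy, classical
Reidemeister move, or multi-virtual detour move. -/
def Move {T : Type u} (D₁ D₂ : Diagram T) : Prop :=
  ∃ u a b v : List (Slice T), D₁.word = u ++ a ++ v ∧ D₂.word = u ++ b ++ v ∧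
    (Isotopy a b ∨ Reidemeister a b ∨ Detour a b)

/-- Equivalence of oriented multi-virtual link diagrams: finitely many moves, in either direction. -/
def Equivalent {T : Type u} : Diagram T → Diagram T → Prop :=
  Relation.EqvGen Move

/-- An operator quandle structure on a quandle `Q`: a list, indexed by the types in `T`, of pairwise
commuting automorphisms of `Q`. The right quandle operation `a * b` is `b ◃ a` in Mathlib. -/
structure OperatorQuandle (T : Type u) (Q : Type v) [Quandle Q] : Type (max u v) where
  op : T → Equiv.Perm Q
  map_act : ∀ α a b, op α (Shelf.act a b) = Shelf.act (op α a) (op α b)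
  comm : ∀ α β, Commute (op α) (op β)

/-- Color change of a strand that crosses another strand of direction `d`: the map `f` sends its color
on the right-hand side of the other strand (with respect to the orientation of the latter) to its
color on the left-hand side. Here `p` is the color of the crossing strand at its right end in the
picture, and `q` the color at its left end; the right end lies on the right-hand side of the other
strand if `d` is up, and on the left-hand side if `d` is down. -/
def Dir.Across {Q : Type v} (d : Dir) (f : Q → Q) (p q : Q) : Prop :=
  match d with
  | .up => q = f p
  | .down => p = f q

/-- The coloring rules. The strand `/` has direction `d` and the colors `x` (bottom left) and `x'`
(top right), the strand `\` has direction `e` and the colors `y` (bottom right) and `y'` (top left).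

At a classical crossing the upper strand keeps its color `b`, and the lower strand has a color `a` to
the right of the upper strand and the color `a * b = b ◃ a` to the left of it. At a virtual crossing
of type `α`, each strand has a color `a` to the right of the other strand and `α a` to the left. For
two upward strands this means that `(x, y)` at the bottom becomes, from left to right at the top,
`(y * x, x)`, `(y, x / y)`, and `(α y, α⁻¹ x)`, respectively. -/
def Kind.Colors {T : Type u} {Q : Type v} [Quandle Q] (A : OperatorQuandle T Q) :
    Kind T → Dir → Dir → Q → Q → Q → Q → Prop
  | .over, d, _, x, y, x', y' => x' = x ∧ d.Across (fun a => Shelf.act x a) y y'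
  | .under, _, e, x, y, x', y' => y' = y ∧ e.Across (fun a => Shelf.act y a) x' x
  | .virt α, d, e, x, y, x', y' => d.Across (A.op α) y y' ∧ e.Across (A.op α) x' x

/-- `x.Colors A s t`: the coloring rules hold in the slice `x` between a lower and an upper level, at
which the strands, listed from left to right, have the directions and the colors in `s` and `t`. -/
inductive Slice.Colors {T : Type u} {Q : Type v} [Quandle Q] (A : OperatorQuandle T Q) :
    Slice T → List (Dir × Q) → List (Dir × Q) → Prop
  | cup (l r : List (Dir × Q)) (d : Dir) (a : Q) :
      Slice.Colors A ⟨l.length, .cup d⟩ (l ++ r) (l ++ (d, a) :: (d.rev, a) :: r)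
  | cap (l r : List (Dir × Q)) (d : Dir) (a : Q) :
      Slice.Colors A ⟨l.length, .cap⟩ (l ++ (d, a) :: (d.rev, a) :: r) (l ++ r)
  | cross (l r : List (Dir × Q)) (k : Kind T) (d e : Dir) (x y x' y' : Q)
      (h : k.Colors A d e x y x' y') :
      Slice.Colors A ⟨l.length, .cross k⟩ (l ++ (d, x) :: (e, y) :: r)
        (l ++ (e, y') :: (d, x') :: r)

/-- The colorings of a tangle diagram with the given directions and colors `s` on the lower and `t`
on the upper boundary: a choice of the colors at all levels in between such that the coloring rules
hold in every slice. (Colors change only at crossings, so this is a choice of a color for each arc;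
the directions are determined by the diagram.) -/
def TangleColoring {T : Type u} {Q : Type v} [Quandle Q] (A : OperatorQuandle T Q) :
    List (Slice T) → List (Dir × Q) → List (Dir × Q) → Type v
  | [], s, t => {_p : PUnit.{v + 1} // s = t}
  | x :: w, s, t => Σ m : {m : List (Dir × Q) // x.Colors A s m}, TangleColoring A w m.1 t

/-- The operator quandle colorings of an oriented multi-virtual link diagram. -/
def Diagram.Coloring {T : Type u} {Q : Type v} [Quandle Q] (D : Diagram T)
    (A : OperatorQuandle T Q) : Type v :=
  TangleColoring A D.word [] []

/-- The number of operator quandle colorings, as a cardinal number. -/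
noncomputable def Diagram.numColorings {T : Type u} {Q : Type v} [Quandle Q] (D : Diagram T)
    (A : OperatorQuandle T Q) : Cardinal.{v} :=
  Cardinal.mk (D.Coloring A)

end MultiVirtual

/-!
The colorings of a stack of tangle diagrams are tuples of colorings of the parts that agree on the
levels in between (`tangleColoringAppend`), so the theorem is local: it is enough to know that both
sides of a move have equally many colorings for any fixed coloring of the boundary. This is
`LocallyEquivalent`; it assumes that the directions at the lower boundary fit both sides, which holds
inside two diagrams because directions propagate upwards in a unique way (`Joins.unique`). A move next
to vertical strands on its left reduces to the move at position `0` (`LocallyEquivalent.shift`).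

Apart from the detour move, both sides of every move have at most one coloring for a given boundary,
because the colors on one side of a crossing determine those on the other side, and every inner arc of
the short diagrams involved runs to the boundary or through a crossing with a strand that does. So the
moves become equivalences between conditions on the boundary (`SameColorings.of_subsingleton`). They
follow from the axioms: the first Reidemeister move from idempotence, the second one from the
bijectivity of the translations, the third one from self-distributivity in the form that a
translation or its inverse preserves the passage across a strand (`Dir.perm_act_act`). This form does
not depend on the orientations.

The detour move is decomposed into moves across a single slice of the tangle, and those into exchanges
of heights and moves across a single piece. A strand that passes a local extremum crosses two antiparallel
strands, and the color changes cancel. Passing a crossing applies `f` or `f⁻¹` to all colors around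
it, where `f` is the automorphism of the type of the strand; this respects classical crossings since
`f` is an automorphism (`Dir.perm_perm_act`) and virtual ones since the automorphisms commute
(`Dir.perm_comm`). The same commutativity shows that the color of the passing strand does not depend
on the order in which it meets the two strands.
-/

namespace MultiVirtual

universe u v

/-! ### Color changes -/

/-- The permutation of the colors that a strand undergoes when it crosses, from right to left in the
picture, a strand of direction `d`, if `f` is the color change from the right-hand side to the
left-hand side of the latter with respect to its orientation. -/
def Dir.perm {Q : Type v} (d : Dir) (f : Equiv.Perm Q) : Equiv.Perm Q :=
  match d with
  | .up => f
  | .down => f.symm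

theorem Dir.across_iff {Q : Type v} {d : Dir} {f : Equiv.Perm Q} {p q : Q} :
    d.Across f p q ↔ q = d.perm f p := by
  cases d
  · rfl
  · rw [Dir.Across, Dir.perm, Equiv.eq_symm_apply, eq_comm]

theorem Dir.across_iff' {Q : Type v} {d : Dir} {f : Equiv.Perm Q} {p q : Q} :
    d.Across f p q ↔ p = d.rev.perm f q := by
  cases d
  · rw [Dir.Across, Dir.rev, Dir.perm, Equiv.eq_symm_apply, eq_comm]
  · rfl

@[simp]
theorem Dir.rev_rev (d : Dir) : d.rev.rev = d := by cases d <;> rfl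

@[simp]
theorem Dir.perm_rev_perm {Q : Type v} (d : Dir) (f : Equiv.Perm Q) (x : Q) :
    d.perm f (d.rev.perm f x) = x := by
  cases d <;> simp [Dir.perm, Dir.rev]

@[simp]
theorem Dir.perm_perm_rev {Q : Type v} (d : Dir) (f : Equiv.Perm Q) (x : Q) :
    d.rev.perm f (d.perm f x) = x := by
  cases d <;> simp [Dir.perm, Dir.rev]

theorem Dir.perm_comm {Q : Type v} (d e : Dir) {f g : Equiv.Perm Q} (h : Commute f g) (x : Q) :
    d.perm f (e.perm g x) = e.perm g (d.perm f x) := by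
  have : Commute (d.perm f) (e.perm g) := by
    cases d <;> cases e
    exacts [h, h.inv_right, h.inv_left, h.inv_inv]
  exact DFunLike.congr_fun this.eq x

variable {Q : Type v} [Quandle Q]

/-- A permutation, or its inverse, that preserves the quandle operation also preserves the passage
across a strand, with either orientation. -/
theorem Dir.perm_perm_act (d e : Dir) {f : Equiv.Perm Q}
    (hf : ∀ a b, f (Shelf.act a b) = Shelf.act (f a) (f b)) (x y : Q) :
    d.perm f (e.perm (Rack.act' x) y) = e.perm (Rack.act' (d.perm f x)) (d.perm f y) := by
  have key (g : Equiv.Perm Q) (hg : ∀ a b, g (Shelf.act a b) = Shelf.act (g a) (g b)) :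
      g (e.perm (Rack.act' x) y) = e.perm (Rack.act' (g x)) (g y) := by
    cases e
    · exact hg x y
    · rw [Dir.perm, Dir.perm, Equiv.eq_symm_apply, Rack.act'_apply, ← hg, ← Rack.act'_apply,
        Equiv.apply_symm_apply]
  cases d
  · exact key f hf
  · refine key f.symm fun a b => ?_
    rw [Equiv.symm_apply_eq, hf, Equiv.apply_symm_apply, Equiv.apply_symm_apply]

theorem Dir.perm_act_act (d e : Dir) (w x y : Q) :
    d.perm (Rack.act' w) (e.perm (Rack.act' x) y) =
      e.perm (Rack.act' (d.perm (Rack.act' w) x)) (d.perm (Rack.act' w) y) :=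
  Dir.perm_perm_act d e (fun _ _ => Shelf.self_distrib) x y

@[simp]
theorem Dir.perm_act_self (d : Dir) (x : Q) : d.perm (Rack.act' x) x = x := by
  cases d
  · exact Quandle.fix
  · rw [Dir.perm, Equiv.symm_apply_eq]
    exact Quandle.fix.symm

/-! ### Colorings of slices -/

variable {T : Type u} (A : OperatorQuandle T Q)

/-- The coloring rule of a piece without the vertical strands beside it. -/
def Piece.Colors : Piece T → List (Dir × Q) → List (Dir × Q) → Prop
  | .cup d, s, m => s = [] ∧ ∃ a, m = [(d, a), (d.rev, a)]
  | .cap, s, m => (∃ d a, s = [(d, a), (d.rev, a)]) ∧ m = []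
  | .cross k, s, m => ∃ d e x y x' y', k.Colors A d e x y x' y' ∧
      s = [(d, x), (e, y)] ∧ m = [(e, y'), (d, x')]

variable {A}

theorem Piece.Colors.length_bottom {p : Piece T} {s m : List (Dir × Q)} (h : p.Colors A s m) :
    s.length = p.numBottom := by
  cases p with
  | cup d => obtain ⟨rfl, -⟩ := h; rfl
  | cap => obtain ⟨⟨d, a, rfl⟩, -⟩ := h; rfl
  | cross k => obtain ⟨d, e, x, y, x', y', -, rfl, -⟩ := h; rfl

theorem Piece.Colors.length_top {p : Piece T} {s m : List (Dir × Q)} (h : p.Colors A s m) :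
    m.length = p.numTop := by
  cases p with
  | cup d => obtain ⟨-, a, rfl⟩ := h; rfl
  | cap => obtain ⟨-, rfl⟩ := h; rfl
  | cross k => obtain ⟨d, e, x, y, x', y', -, -, rfl⟩ := h; rfl

theorem Slice.colors_iff {i : ℕ} {p : Piece T} {S S' : List (Dir × Q)} :
    Slice.Colors A ⟨i, p⟩ S S' ↔
      ∃ l s m r, l.length = i ∧ S = l ++ (s ++ r) ∧ S' = l ++ (m ++ r) ∧ p.Colors A s m := by
  constructor
  · rintro (⟨l, r, d, a⟩ | ⟨l, r, d, a⟩ | ⟨l, r, k, d, e, x, y, x', y', h⟩)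
    · exact ⟨l, [], _, r, rfl, rfl, rfl, rfl, a, rfl⟩
    · exact ⟨l, _, [], r, rfl, rfl, rfl, ⟨d, a, rfl⟩, rfl⟩
    · exact ⟨l, _, _, r, rfl, rfl, rfl, d, e, x, y, x', y', h, rfl, rfl⟩
  · rintro ⟨l, s, m, r, rfl, rfl, rfl, h⟩
    cases p with
    | cup d => obtain ⟨rfl, a, rfl⟩ := h; exact .cup l r d a
    | cap => obtain ⟨⟨d, a, rfl⟩, rfl⟩ := h; exact .cap l r d a
    | cross k =>
      obtain ⟨d, e, x, y, x', y', h, rfl, rfl⟩ := h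
      exact .cross l r k d e x y x' y' h

theorem Slice.colors_zero_iff {p : Piece T} {S S' : List (Dir × Q)} :
    Slice.Colors A ⟨0, p⟩ S S' ↔ ∃ s m r, S = s ++ r ∧ S' = m ++ r ∧ p.Colors A s m := by
  simp [Slice.colors_iff]

@[simp]
theorem Slice.colors_succ {i : ℕ} {p : Piece T} {S S' : List (Dir × Q)} :
    Slice.Colors A ⟨i + 1, p⟩ S S' ↔
      ∃ h S₁ S₁', S = h :: S₁ ∧ S' = h :: S₁' ∧ Slice.Colors A ⟨i, p⟩ S₁ S₁' := by
  simp only [Slice.colors_iff]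
  constructor
  · rintro ⟨l, s, m, r, hl, rfl, rfl, h⟩
    obtain ⟨a, l, rfl⟩ := List.exists_cons_of_length_eq_add_one hl
    exact ⟨a, _, _, rfl, rfl, l, s, m, r, by simpa using hl, rfl, rfl, h⟩
  · rintro ⟨a, _, _, rfl, rfl, l, s, m, r, rfl, rfl, rfl, h⟩
    exact ⟨a :: l, s, m, r, rfl, rfl, rfl, h⟩

@[simp]
theorem Slice.colors_one {p : Piece T} {S S' : List (Dir × Q)} :
    Slice.Colors A ⟨1, p⟩ S S' ↔
      ∃ h S₁ S₁', S = h :: S₁ ∧ S' = h :: S₁' ∧ Slice.Colors A ⟨0, p⟩ S₁ S₁' :=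
  Slice.colors_succ

/-- A slice acts to the right of a block of vertical strands without changing the block. -/
theorem Slice.colors_append {i : ℕ} {p : Piece T} {l S S' : List (Dir × Q)} :
    Slice.Colors A ⟨l.length + i, p⟩ (l ++ S) S' ↔
      ∃ S₁', S' = l ++ S₁' ∧ Slice.Colors A ⟨i, p⟩ S S₁' := by
  induction l generalizing S' with
  | nil => simp
  | cons a l ih =>
    rw [List.length_cons, show l.length + 1 + i = l.length + i + 1 by omega, Slice.colors_succ]
    constructor
    · rintro ⟨h, S₁, S₁', h₁, rfl, h₂⟩
      obtain ⟨rfl, rfl⟩ := List.cons.inj h₁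
      obtain ⟨S₂, rfl, h₃⟩ := ih.1 h₂
      exact ⟨S₂, rfl, h₃⟩
    · rintro ⟨S₁', rfl, h⟩
      exact ⟨a, _, _, rfl, rfl, ih.2 ⟨_, rfl, h⟩⟩

theorem Slice.append_colors {i : ℕ} {p : Piece T} {l S S' : List (Dir × Q)} :
    Slice.Colors A ⟨l.length + i, p⟩ S (l ++ S') ↔
      ∃ S₁, S = l ++ S₁ ∧ Slice.Colors A ⟨i, p⟩ S₁ S' := by
  induction l generalizing S with
  | nil => simp
  | cons a l ih =>
    rw [List.length_cons, show l.length + 1 + i = l.length + i + 1 by omega, Slice.colors_succ]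
    constructor
    · rintro ⟨h, S₁, S₁', rfl, h₁, h₂⟩
      obtain ⟨rfl, rfl⟩ := List.cons.inj h₁
      obtain ⟨S₂, rfl, h₃⟩ := ih.1 h₂
      exact ⟨S₂, rfl, h₃⟩
    · rintro ⟨S₁', rfl, h⟩
      exact ⟨a, _, _, rfl, rfl, ih.2 ⟨_, rfl, h⟩⟩

@[simp]
theorem Slice.colors_zero_cup {d : Dir} {S S' : List (Dir × Q)} :
    Slice.Colors A ⟨0, .cup d⟩ S S' ↔ ∃ a, S' = (d, a) :: (d.rev, a) :: S := by
  rw [Slice.colors_zero_iff]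
  constructor
  · rintro ⟨_, _, r, rfl, rfl, rfl, a, rfl⟩
    exact ⟨a, rfl⟩
  · rintro ⟨a, rfl⟩
    exact ⟨_, _, S, rfl, rfl, rfl, a, rfl⟩

@[simp]
theorem Slice.colors_zero_cap {S S' : List (Dir × Q)} :
    Slice.Colors A ⟨0, .cap⟩ S S' ↔ ∃ d a, S = (d, a) :: (d.rev, a) :: S' := by
  rw [Slice.colors_zero_iff]
  constructor
  · rintro ⟨_, _, r, rfl, rfl, ⟨d, a, rfl⟩, rfl⟩
    exact ⟨d, a, rfl⟩
  · rintro ⟨d, a, rfl⟩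
    exact ⟨_, _, S', rfl, rfl, ⟨d, a, rfl⟩, rfl⟩

variable (A)

/-- The color at the top left of a crossing: `d` is the direction of the strand `/`, and `x`, `y`
are the colors at the bottom. -/
def Kind.left : Kind T → Dir → Q → Q → Q
  | .over, d, x, y => d.perm (Rack.act' x) y
  | .under, _, _, y => y
  | .virt α, d, _, y => d.perm (A.op α) y

/-- The color at the top right of a crossing: `e` is the direction of the strand `\`, and `x`, `y`
are the colors at the bottom. -/
def Kind.right : Kind T → Dir → Q → Q → Q
  | .over, _, x, _ => x
  | .under, e, x, y => e.rev.perm (Rack.act' y) x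
  | .virt α, e, x, _ => e.rev.perm (A.op α) x

variable {A}

theorem Kind.colors_iff {k : Kind T} {d e : Dir} {x y x' y' : Q} :
    k.Colors A d e x y x' y' ↔ x' = k.right A e x y ∧ y' = k.left A d x y := by
  cases k
  · exact and_congr Iff.rfl (Dir.across_iff (f := Rack.act' x))
  · exact and_comm.trans (and_congr (Dir.across_iff' (f := Rack.act' y)) Iff.rfl)
  · exact and_comm.trans (and_congr Dir.across_iff' Dir.across_iff)

theorem Slice.colors_zero_cross {k : Kind T} {S S' : List (Dir × Q)} :
    Slice.Colors A ⟨0, .cross k⟩ S S' ↔ ∃ d e x y r, S = (d, x) :: (e, y) :: r ∧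
      S' = (e, k.left A d x y) :: (d, k.right A e x y) :: r := by
  rw [Slice.colors_zero_iff]
  constructor
  · rintro ⟨_, _, r, rfl, rfl, d, e, x, y, x', y', h, rfl, rfl⟩
    obtain ⟨rfl, rfl⟩ := Kind.colors_iff.1 h
    exact ⟨d, e, x, y, r, rfl, rfl⟩
  · rintro ⟨d, e, x, y, r, rfl, rfl⟩
    exact ⟨_, _, r, rfl, rfl, d, e, x, y, _, _, Kind.colors_iff.2 ⟨rfl, rfl⟩, rfl, rfl⟩

@[simp]
theorem Slice.colors_cross_cons_cons {k : Kind T} {d e : Dir} {x y : Q} {r S' : List (Dir × Q)} :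
    Slice.Colors A ⟨0, .cross k⟩ ((d, x) :: (e, y) :: r) S' ↔
      S' = (e, k.left A d x y) :: (d, k.right A e x y) :: r := by
  rw [Slice.colors_zero_cross]
  constructor
  · rintro ⟨d, e, x, y, r, h, rfl⟩
    obtain ⟨⟨⟩, ⟨⟩, rfl⟩ := by simpa only [List.cons.injEq] using h
    rfl
  · rintro rfl
    exact ⟨_, _, _, _, _, rfl, rfl⟩

@[simp]
theorem Slice.not_colors_cross_nil {k : Kind T} {S' : List (Dir × Q)} :
    ¬ Slice.Colors A ⟨0, .cross k⟩ [] S' := by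
  simp [Slice.colors_zero_cross]

@[simp]
theorem Slice.not_colors_cross_singleton {k : Kind T} {a : Dir × Q} {S' : List (Dir × Q)} :
    ¬ Slice.Colors A ⟨0, .cross k⟩ [a] S' := by
  simp [Slice.colors_zero_cross]

/-- Except at a local minimum, the colors below a slice determine the colors above it. -/
theorem Slice.Colors.top_unique {x : Slice T} (hx : ∀ d, x.piece ≠ .cup d)
    {S M M' : List (Dir × Q)} (h : x.Colors A S M) (h' : x.Colors A S M') : M = M' := by
  obtain ⟨i, p⟩ := x
  rw [Slice.colors_iff] at h h'
  obtain ⟨l, s, m, r, hl, rfl, rfl, h⟩ := h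
  obtain ⟨l', s', m', r', hl', hS, rfl, h'⟩ := h'
  obtain ⟨rfl, hS'⟩ := List.append_inj hS (hl.trans hl'.symm)
  obtain ⟨rfl, rfl⟩ := List.append_inj hS' (h.length_bottom.trans h'.length_bottom.symm)
  suffices m = m' by rw [this]
  cases p with
  | cup d => exact absurd rfl (hx d)
  | cap => rw [h.2, h'.2]
  | cross k =>
    obtain ⟨d, e, x, y, x', y', h, rfl, rfl⟩ := h
    obtain ⟨d, e, x, y, x', y', h', hs, rfl⟩ := h'
    simp only [List.cons.injEq, Prod.mk.injEq, and_true] at hs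
    obtain ⟨⟨rfl, rfl⟩, rfl, rfl⟩ := hs
    rw [Kind.colors_iff] at h h'
    rw [h.1, h.2, h'.1, h'.2]

/-- Except at a local maximum, the colors above a slice determine the colors below it. -/
theorem Slice.Colors.bottom_unique {x : Slice T} (hx : x.piece ≠ .cap)
    {S S' M : List (Dir × Q)} (h : x.Colors A S M) (h' : x.Colors A S' M) : S = S' := by
  obtain ⟨i, p⟩ := x
  rw [Slice.colors_iff] at h h'
  obtain ⟨l, s, m, r, hl, rfl, rfl, h⟩ := h
  obtain ⟨l', s', m', r', hl', rfl, hS, h'⟩ := h'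
  obtain ⟨rfl, hS'⟩ := List.append_inj hS (hl.trans hl'.symm)
  obtain ⟨rfl, rfl⟩ := List.append_inj hS' (h.length_top.trans h'.length_top.symm)
  suffices s = s' by rw [this]
  cases p with
  | cup d => rw [h.1, h'.1]
  | cap => exact absurd rfl hx
  | cross k =>
    obtain ⟨d, e, x, y, x', y', h, rfl, rfl⟩ := h
    obtain ⟨d', e', x₂, y₂, x₂', y₂', h', rfl, hs⟩ := h'
    simp only [List.cons.injEq, Prod.mk.injEq, and_true] at hs
    obtain ⟨⟨rfl, rfl⟩, rfl, rfl⟩ := hs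
    rw [Kind.colors_iff] at h h'
    obtain ⟨h₁, h₂⟩ := h
    obtain ⟨h₁', h₂'⟩ := h'
    cases k <;> simp_all [Kind.left, Kind.right]

/-! ### Colorings of tangle diagrams with a given boundary -/

variable (A)

/-- The tangle diagram has a coloring with the given boundary. -/
def Colored : List (Slice T) → List (Dir × Q) → List (Dir × Q) → Prop
  | [], S, S' => S = S'
  | x :: w, S, S' => ∃ M, x.Colors A S M ∧ Colored w M S'

/-- The tangle diagrams `a` and `b` have equally many colorings with lower boundary `S` and upper
boundary `S'`. -/
def SameColorings (a b : List (Slice T)) (S S' : List (Dir × Q)) : Prop :=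
  Nonempty (TangleColoring A a S S' ≃ TangleColoring A b S S')

/-- A coloring of two stacked tangle diagrams consists of colorings of both that agree on the level
between them. -/
def tangleColoringAppend : (a b : List (Slice T)) → (S S' : List (Dir × Q)) →
    (TangleColoring A (a ++ b) S S' ≃
      Σ M : List (Dir × Q), TangleColoring A a S M × TangleColoring A b M S')
  | [], b, S, S' =>
    { toFun := fun c => ⟨S, ⟨⟨⟩, rfl⟩, c⟩
      invFun := fun ⟨_, ⟨_, h⟩, c⟩ => h ▸ c
      left_inv := fun _ => rfl
      right_inv := by rintro ⟨_, ⟨⟨⟩, rfl⟩, c⟩; rfl }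
  | x :: a, b, S, S' =>
    (Equiv.sigmaCongrRight fun M : {m // x.Colors A S m} =>
      tangleColoringAppend a b M.1 S').trans
    { toFun := fun ⟨N, M, c, c'⟩ => ⟨M, ⟨N, c⟩, c'⟩
      invFun := fun ⟨M, ⟨N, c⟩, c'⟩ => ⟨N, M, c, c'⟩
      left_inv := fun _ => rfl
      right_inv := fun _ => rfl }

/-- A vertical strand to the left of a tangle diagram does not affect the colorings. -/
def tangleColoringShift (h : Dir × Q) : (w : List (Slice T)) → (S S' : List (Dir × Q)) →
    (TangleColoring A w S S' ≃ TangleColoring A (shift 1 w) (h :: S) (h :: S'))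
  | [], S, S' =>
    Equiv.subtypeEquivRight fun _ => ⟨congrArg _, fun e => (List.cons.inj e).2⟩
  | x :: w, S, S' =>
    Equiv.sigmaCongr
      (β₂ := fun M : {m // Slice.Colors A ⟨1 + x.pos, x.piece⟩ (h :: S) m} =>
        TangleColoring A (shift 1 w) M.1 (h :: S'))
      { toFun := fun M => ⟨h :: M.1,
          by rw [Nat.add_comm, Slice.colors_succ]; exact ⟨h, _, _, rfl, rfl, M.2⟩⟩
        invFun := fun M => ⟨M.1.tail, by
          obtain ⟨M, hM⟩ := M
          rw [Nat.add_comm, Slice.colors_succ] at hM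
          obtain ⟨_, _, _, h₁, rfl, h₂⟩ := hM
          obtain ⟨rfl, rfl⟩ := List.cons.inj h₁
          exact h₂⟩
        left_inv := fun _ => rfl
        right_inv := by
          rintro ⟨M, hM⟩
          have hM' := hM
          rw [Nat.add_comm, Slice.colors_succ] at hM'
          obtain ⟨_, _, _, h₁, rfl, h₂⟩ := hM'
          obtain ⟨rfl, rfl⟩ := List.cons.inj h₁
          rfl }
      fun M => tangleColoringShift h w M.1 S'

variable {A}

theorem nonempty_tangleColoring {w : List (Slice T)} {S S' : List (Dir × Q)} :
    Nonempty (TangleColoring A w S S') ↔ Colored A w S S' := by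
  induction w generalizing S with
  | nil => exact ⟨fun ⟨c⟩ => c.2, fun h => ⟨⟨⟨⟩, h⟩⟩⟩
  | cons x w ih =>
    exact ⟨fun ⟨⟨M, c⟩⟩ => ⟨M.1, M.2, ih.1 ⟨c⟩⟩, fun ⟨M, h, h'⟩ =>
      (ih.2 h').elim fun c => ⟨⟨⟨M, h⟩, c⟩⟩⟩

theorem Colored.of_shift_one {w : List (Slice T)} {h : Dir × Q} {S S' : List (Dir × Q)}
    (hw : Colored A (shift 1 w) (h :: S) S') : ∃ S₁, S' = h :: S₁ := by
  induction w generalizing S with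
  | nil => exact ⟨S, Eq.symm hw⟩
  | cons x w ih =>
    obtain ⟨M, hM, hw⟩ := hw
    dsimp only at hM
    rw [Nat.add_comm, Slice.colors_succ] at hM
    obtain ⟨_, _, _, h₁, rfl, h₂⟩ := hM
    obtain ⟨rfl, rfl⟩ := List.cons.inj h₁
    exact ih hw

theorem isEmpty_tangleColoring {w : List (Slice T)} {S S' : List (Dir × Q)}
    (h : ¬ Colored A w S S') : IsEmpty (TangleColoring A w S S') :=
  not_nonempty_iff.1 fun h' => h (nonempty_tangleColoring.1 h')

namespace SameColorings

variable {a b c : List (Slice T)} {S S' : List (Dir × Q)}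

theorem refl (a : List (Slice T)) (S S' : List (Dir × Q)) : SameColorings A a a S S' :=
  ⟨Equiv.refl _⟩

theorem symm (h : SameColorings A a b S S') : SameColorings A b a S S' :=
  h.elim fun e => ⟨e.symm⟩

theorem trans (h : SameColorings A a b S S') (h' : SameColorings A b c S S') :
    SameColorings A a c S S' :=
  h.elim fun e => h'.elim fun e' => ⟨e.trans e'⟩

theorem of_not_colored (ha : ¬ Colored A a S S') (hb : ¬ Colored A b S S') :
    SameColorings A a b S S' :=
  have := isEmpty_tangleColoring ha
  have := isEmpty_tangleColoring hb
  ⟨Equiv.equivOfIsEmpty _ _⟩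

/-- If the boundary determines the colorings of two tangle diagrams, then it suffices to compare
their existence. -/
theorem of_subsingleton (ha : Subsingleton (TangleColoring A a S S'))
    (hb : Subsingleton (TangleColoring A b S S'))
    (h : Colored A a S S' ↔ Colored A b S S') : SameColorings A a b S S' := by
  by_cases h' : Colored A a S S'
  · obtain ⟨x⟩ := nonempty_tangleColoring.2 h'
    obtain ⟨y⟩ := nonempty_tangleColoring.2 (h.1 h')
    exact ⟨equivOfSubsingletonOfSubsingleton (fun _ => y) fun _ => x⟩
  · exact of_not_colored h' (mt h.2 h')

theorem append_left (u : List (Slice T))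
    (h : ∀ M, Colored A u S M → SameColorings A a b M S') :
    SameColorings A (u ++ a) (u ++ b) S S' :=
  ⟨(tangleColoringAppend A u a S S').trans <|
    (Equiv.sigmaCongrRight fun M => Equiv.prodShear (Equiv.refl _) fun c =>
      (h M (nonempty_tangleColoring.1 ⟨c⟩)).some).trans (tangleColoringAppend A u b S S').symm⟩

theorem append_right (v : List (Slice T)) (h : ∀ M, SameColorings A a b S M) :
    SameColorings A (a ++ v) (b ++ v) S S' :=
  ⟨(tangleColoringAppend A a v S S').trans <|
    (Equiv.sigmaCongrRight fun M => Equiv.prodCongr (h M).some (Equiv.refl _)).trans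
      (tangleColoringAppend A b v S S').symm⟩

theorem cons (x : Slice T) (h : ∀ M, x.Colors A S M → SameColorings A a b M S') :
    SameColorings A (x :: a) (x :: b) S S' :=
  append_left [x] fun M ⟨_, hx, hM⟩ => h M (hM ▸ hx)

theorem shift_one {h : Dir × Q} (H : ∀ S', SameColorings A a b S S') :
    SameColorings A (shift 1 a) (shift 1 b) (h :: S) S' := by
  by_cases hS : ∃ S₁, S' = h :: S₁
  · obtain ⟨S₁, rfl⟩ := hS
    exact ⟨(tangleColoringShift A h a S S₁).symm.trans <|
      (H S₁).some.trans (tangleColoringShift A h b S S₁)⟩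
  · exact of_not_colored (fun h' => hS h'.of_shift_one) fun h' => hS h'.of_shift_one

end SameColorings

theorem subsingleton_nil (S S' : List (Dir × Q)) : Subsingleton (TangleColoring A [] S S') :=
  ⟨fun _ _ => Subtype.ext rfl⟩

theorem subsingleton_cons {x : Slice T} {w : List (Slice T)} {S S' : List (Dir × Q)}
    (h : ∀ M M', x.Colors A S M → Colored A w M S' → x.Colors A S M' → Colored A w M' S' → M = M')
    (hw : ∀ M, Subsingleton (TangleColoring A w M S')) :
    Subsingleton (TangleColoring A (x :: w) S S') := by
  refine ⟨?_⟩
  rintro ⟨⟨M, hM⟩, c⟩ ⟨⟨M', hM'⟩, c'⟩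
  obtain rfl := h M M' hM (nonempty_tangleColoring.1 ⟨c⟩) hM' (nonempty_tangleColoring.1 ⟨c'⟩)
  obtain rfl := (hw M).elim c c'
  rfl

/-- Without local minima, the lower boundary determines the coloring. -/
theorem subsingleton_of_no_cup {w : List (Slice T)} (hw : ∀ x ∈ w, ∀ d, x.piece ≠ .cup d)
    (S S' : List (Dir × Q)) : Subsingleton (TangleColoring A w S S') := by
  induction w generalizing S with
  | nil => exact subsingleton_nil S S'
  | cons x w ih =>
    rw [List.forall_mem_cons] at hw
    exact subsingleton_cons (fun M M' h _ h' _ => h.top_unique hw.1 h') fun M => ih hw.2 M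

theorem Colored.bottom_unique {w : List (Slice T)} (hw : ∀ x ∈ w, x.piece ≠ .cap)
    {S S₁ S' : List (Dir × Q)} (h : Colored A w S S') (h' : Colored A w S₁ S') : S = S₁ := by
  induction w generalizing S S₁ with
  | nil => exact Eq.trans h (Eq.symm h')
  | cons x w ih =>
    rw [List.forall_mem_cons] at hw
    obtain ⟨M, hM, h⟩ := h
    obtain ⟨M', hM', h'⟩ := h'
    obtain rfl := ih hw.2 h h'
    exact hM.bottom_unique hw.1 hM'

/-- Without local maxima, the upper boundary determines the coloring. -/
theorem subsingleton_of_no_cap {w : List (Slice T)} (hw : ∀ x ∈ w, x.piece ≠ .cap)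
    (S S' : List (Dir × Q)) : Subsingleton (TangleColoring A w S S') := by
  induction w generalizing S with
  | nil => exact subsingleton_nil S S'
  | cons x w ih =>
    rw [List.forall_mem_cons] at hw
    exact subsingleton_cons (fun M M' _ h _ h' => h.bottom_unique hw.2 h') fun M => ih hw.2 M

/-! ### Orientations of the strands -/

theorem Slice.joins_succ {i : ℕ} {p : Piece T} {s t : List Dir} :
    Slice.Joins ⟨i + 1, p⟩ s t →
      ∃ d s₁ t₁, s = d :: s₁ ∧ t = d :: t₁ ∧ Slice.Joins ⟨i, p⟩ s₁ t₁ := by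
  generalize hx : (⟨i + 1, p⟩ : Slice T) = x
  rintro (⟨_ | ⟨a, l⟩, r, d⟩ | ⟨_ | ⟨a, l⟩, r, d⟩ | ⟨_ | ⟨a, l⟩, r, k, d, e⟩) <;>
    simp only [Slice.mk.injEq, List.length_nil, List.length_cons, Nat.add_right_cancel_iff,
      Nat.add_one_ne_zero, false_and] at hx
  all_goals obtain ⟨rfl, rfl⟩ := hx
  exacts [⟨a, _, _, rfl, rfl, .cup l r d⟩, ⟨a, _, _, rfl, rfl, .cap l r d⟩,
    ⟨a, _, _, rfl, rfl, .cross l r k d e⟩]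

theorem Slice.joins_zero_cup {d : Dir} {s t : List Dir} :
    Slice.Joins (T := T) ⟨0, .cup d⟩ s t → t = d :: d.rev :: s := by
  generalize hx : (⟨0, .cup d⟩ : Slice T) = x
  rintro (⟨_ | ⟨a, l⟩, r, d⟩ | ⟨_ | ⟨a, l⟩, r, d⟩ | ⟨_ | ⟨a, l⟩, r, k, d, e⟩) <;> cases hx
  rfl

theorem Slice.joins_zero_cap {s t : List Dir} :
    Slice.Joins (T := T) ⟨0, .cap⟩ s t → ∃ d, s = d :: d.rev :: t := by
  generalize hx : (⟨0, .cap⟩ : Slice T) = x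
  rintro (⟨_ | ⟨a, l⟩, r, d⟩ | ⟨_ | ⟨a, l⟩, r, d⟩ | ⟨_ | ⟨a, l⟩, r, k, d, e⟩) <;> cases hx
  exact ⟨d, rfl⟩

theorem Slice.joins_zero_cross {k : Kind T} {s t : List Dir} :
    Slice.Joins (T := T) ⟨0, .cross k⟩ s t →
      ∃ d e r, s = d :: e :: r ∧ t = e :: d :: r := by
  generalize hx : (⟨0, .cross k⟩ : Slice T) = x
  rintro (⟨_ | ⟨a, l⟩, r, d⟩ | ⟨_ | ⟨a, l⟩, r, d⟩ | ⟨_ | ⟨a, l⟩, r, k, d, e⟩) <;> cases hx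
  exact ⟨d, e, r, rfl, rfl⟩

/-- The directions below a slice determine the directions above it. -/
theorem Slice.Joins.unique {x : Slice T} {s t t' : List Dir} (h : x.Joins s t)
    (h' : x.Joins s t') : t = t' := by
  obtain ⟨i, p⟩ := x
  induction i generalizing s t t' with
  | zero =>
    cases p with
    | cup d => rw [Slice.joins_zero_cup h, Slice.joins_zero_cup h']
    | cap =>
      obtain ⟨d, rfl⟩ := Slice.joins_zero_cap h
      obtain ⟨d, hd⟩ := Slice.joins_zero_cap h'
      exact (List.cons.inj (List.cons.inj hd).2).2
    | cross k =>
      obtain ⟨d, e, r, rfl, rfl⟩ := Slice.joins_zero_cross h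
      obtain ⟨d, e, r, hs, rfl⟩ := Slice.joins_zero_cross h'
      simp only [List.cons.injEq] at hs
      simp [hs]
  | succ i ih =>
    obtain ⟨d, s, t, rfl, rfl, h₁⟩ := Slice.joins_succ h
    obtain ⟨d', s', t', hs, rfl, h₂⟩ := Slice.joins_succ h'
    obtain ⟨rfl, rfl⟩ := List.cons.inj hs
    rw [ih h₁ h₂]

theorem Joins.unique {w : List (Slice T)} {s t t' : List Dir} (h : Joins w s t)
    (h' : Joins w s t') : t = t' := by
  induction w generalizing s with
  | nil => exact Eq.trans (Eq.symm h) h'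
  | cons x w ih =>
    obtain ⟨m, hm, h⟩ := h
    obtain ⟨m', hm', h'⟩ := h'
    obtain rfl := hm.unique hm'
    exact ih h h'

theorem joins_append {a b : List (Slice T)} {s t : List Dir} (h : Joins (a ++ b) s t) :
    ∃ m, Joins a s m ∧ Joins b m t := by
  induction a generalizing s with
  | nil => exact ⟨s, rfl, h⟩
  | cons x a ih =>
    obtain ⟨m, hm, h⟩ := h
    obtain ⟨m', h₁, h₂⟩ := ih h
    exact ⟨m', ⟨m, hm, h₁⟩, h₂⟩

theorem Slice.Colors.joins {x : Slice T} {S S' : List (Dir × Q)} (h : x.Colors A S S') :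
    x.Joins (S.map Prod.fst) (S'.map Prod.fst) := by
  cases h with
  | cup l r d a =>
    simpa using Slice.Joins.cup (T := T) (l.map Prod.fst) (r.map Prod.fst) d
  | cap l r d a =>
    simpa using Slice.Joins.cap (T := T) (l.map Prod.fst) (r.map Prod.fst) d
  | cross l r k d e x y x' y' h =>
    simpa using Slice.Joins.cross (T := T) (l.map Prod.fst) (r.map Prod.fst) k d e

theorem Colored.joins {w : List (Slice T)} {S S' : List (Dir × Q)} (h : Colored A w S S') :
    Joins w (S.map Prod.fst) (S'.map Prod.fst) := by
  induction w generalizing S with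
  | nil => exact congrArg _ h
  | cons x w ih =>
    obtain ⟨M, hM, h⟩ := h
    exact ⟨_, hM.joins, ih h⟩

theorem Joins.of_shift_one {w : List (Slice T)} {d : Dir} {s t : List Dir}
    (h : Joins (shift 1 w) (d :: s) t) : ∃ t₁, Joins w s t₁ := by
  induction w generalizing s with
  | nil => exact ⟨s, rfl⟩
  | cons x w ih =>
    obtain ⟨m, hm, h⟩ := h
    dsimp only at hm
    rw [Nat.add_comm] at hm
    obtain ⟨_, _, m, h₁, rfl, h₂⟩ := Slice.joins_succ hm
    obtain ⟨rfl, rfl⟩ := List.cons.inj h₁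
    obtain ⟨t₁, h₃⟩ := ih h
    exact ⟨t₁, m, h₂, h₃⟩

/-! ### Locality of the moves -/

theorem shift_shift (i j : ℕ) (w : List (Slice T)) : shift i (shift j w) = shift (i + j) w := by
  simp [shift, Function.comp_def, Nat.add_assoc]

@[simp]
theorem shift_zero (w : List (Slice T)) : shift 0 w = w := by
  simp [shift]

theorem shift_append (i : ℕ) (a b : List (Slice T)) :
    shift i (a ++ b) = shift i a ++ shift i b :=
  List.map_append

/-- If some strand lies to the left of a nonempty tangle diagram, then its lower boundary is
nonempty. -/
theorem Joins.shift_eq_nil {i : ℕ} (hi : 0 < i) {w : List (Slice T)} {t : List Dir}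
    (h : Joins (shift i w) [] t) : w = [] := by
  cases w with
  | nil => rfl
  | cons x w =>
    obtain ⟨m, hm, -⟩ := h
    obtain ⟨j, rfl⟩ := Nat.exists_eq_add_of_lt hi
    dsimp only at hm
    rw [show 0 + j + 1 + x.pos = j + x.pos + 1 by omega] at hm
    obtain ⟨_, _, _, h, -⟩ := Slice.joins_succ hm
    cases h

variable (A) in
/-- The tangle diagrams `a` and `b` have equally many colorings with any given boundary, provided
that the directions of the strands at the lower boundary fit both of them. -/
def LocallyEquivalent (a b : List (Slice T)) : Prop :=
  ∀ S S' : List (Dir × Q), (∃ t, Joins a (S.map Prod.fst) t) → (∃ t, Joins b (S.map Prod.fst) t) →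
    SameColorings A a b S S'

theorem LocallyEquivalent.shift {a b : List (Slice T)} (h : LocallyEquivalent A a b) (i : ℕ) :
    LocallyEquivalent A (shift i a) (shift i b) := by
  induction i with
  | zero => simpa using h
  | succ i ih =>
    rintro (_ | ⟨x, S⟩) S' ⟨t, ha⟩ ⟨t', hb⟩
    · rw [ha.shift_eq_nil i.succ_pos, hb.shift_eq_nil i.succ_pos]
      exact .refl _ _ _
    · rw [Nat.add_comm, ← shift_shift] at ha hb ⊢
      rw [← shift_shift]
      exact .shift_one fun S' => ih S S' ha.of_shift_one hb.of_shift_one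

/-- Replacing a part of a diagram by a locally equivalent one preserves the number of colorings: the
directions on the level below the part are determined by the diagram below it. -/
theorem Diagram.numColorings_eq_of_locallyEquivalent {D₁ D₂ : Diagram T} {a b w z : List (Slice T)}
    (h₁ : D₁.word = w ++ a ++ z) (h₂ : D₂.word = w ++ b ++ z) (h : LocallyEquivalent A a b) :
    D₁.numColorings A = D₂.numColorings A := by
  have hD₁ := D₁.joins
  have hD₂ := D₂.joins
  rw [h₁] at hD₁
  rw [h₂] at hD₂
  obtain ⟨_, hD₁, -⟩ := joins_append hD₁
  obtain ⟨s, hs, ha⟩ := joins_append hD₁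
  obtain ⟨_, hD₂, -⟩ := joins_append hD₂
  obtain ⟨s', hs', hb⟩ := joins_append hD₂
  have key : SameColorings A (w ++ a ++ z) (w ++ b ++ z) [] [] := by
    refine .append_right _ fun M => .append_left _ fun N hN => h N M ?_ ?_
    · rw [hN.joins.unique hs]; exact ⟨_, ha⟩
    · rw [hN.joins.unique hs']; exact ⟨_, hb⟩
  refine Cardinal.mk_congr ?_
  rw [Diagram.Coloring, Diagram.Coloring, h₁, h₂]
  exact key.some

/-! ### Planar isotopy -/

/-- Pieces beside one another act on disjoint parts of the boundary, so their order is irrelevant. -/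
theorem sameColorings_exchange (p q : Piece T) (k : ℕ) (S S' : List (Dir × Q)) :
    SameColorings A [⟨0, p⟩, ⟨p.numTop + k, q⟩] [⟨p.numBottom + k, q⟩, ⟨0, p⟩] S S' := by
  refine .of_subsingleton (subsingleton_cons ?_ fun M => ?_) (subsingleton_cons ?_ fun M => ?_) ?_
  · rintro M M' h₁ ⟨_, h₂, rfl⟩ h₁' ⟨_, h₂', rfl⟩
    obtain ⟨s, m, r, rfl, rfl, h⟩ := Slice.colors_zero_iff.1 h₁
    obtain ⟨s', m', r', hs, rfl, h'⟩ := Slice.colors_zero_iff.1 h₁'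
    rw [← h.length_top, Slice.colors_append] at h₂
    rw [← h'.length_top, Slice.colors_append] at h₂'
    obtain ⟨S₁, rfl, -⟩ := h₂
    obtain ⟨S₁', hm, -⟩ := h₂'
    rw [(List.append_inj hs (h.length_bottom.trans h'.length_bottom.symm)).2,
      (List.append_inj hm (h.length_top.trans h'.length_top.symm)).1]
  · exact subsingleton_cons (fun _ _ _ h _ h' => Eq.trans h (Eq.symm h')) fun M =>
      subsingleton_nil _ _
  · rintro M M' h₁ ⟨_, h₂, rfl⟩ h₁' ⟨_, h₂', rfl⟩
    obtain ⟨s, m, r, rfl, rfl, h⟩ := Slice.colors_zero_iff.1 h₂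
    obtain ⟨s', m', r', rfl, hs, h'⟩ := Slice.colors_zero_iff.1 h₂'
    rw [← h.length_bottom, Slice.append_colors] at h₁
    rw [← h'.length_bottom, Slice.append_colors] at h₁'
    obtain ⟨S₁, rfl, -⟩ := h₁
    obtain ⟨S₁', hm, -⟩ := h₁'
    rw [(List.append_inj hs (h.length_top.trans h'.length_top.symm)).2,
      (List.append_inj hm (h.length_bottom.trans h'.length_bottom.symm)).1]
  · exact subsingleton_cons (fun _ _ _ h _ h' => Eq.trans h (Eq.symm h')) fun M =>
      subsingleton_nil _ _
  · constructor
    · rintro ⟨M, h₁, _, h₂, rfl⟩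
      obtain ⟨s, m, r, rfl, rfl, h⟩ := Slice.colors_zero_iff.1 h₁
      rw [← h.length_top, Slice.colors_append] at h₂
      obtain ⟨r', rfl, hq⟩ := h₂
      refine ⟨s ++ r', ?_, _, Slice.colors_zero_iff.2 ⟨s, m, r', rfl, rfl, h⟩, rfl⟩
      rw [← h.length_bottom, Slice.colors_append]
      exact ⟨r', rfl, hq⟩
    · rintro ⟨M, h₁, _, h₂, rfl⟩
      obtain ⟨s, m, r, rfl, rfl, h⟩ := Slice.colors_zero_iff.1 h₂
      rw [← h.length_bottom, Slice.append_colors] at h₁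
      obtain ⟨r', rfl, hq⟩ := h₁
      refine ⟨m ++ r', Slice.colors_zero_iff.2 ⟨s, m, r', rfl, rfl, h⟩, _, ?_, rfl⟩
      rw [← h.length_top, Slice.colors_append]
      exact ⟨r, rfl, hq⟩

theorem locallyEquivalent_zigzag (d : Dir) :
    LocallyEquivalent A [⟨1, .cup d⟩, ⟨0, .cap⟩] [] := by
  rintro S S' ⟨t, m, hm, m', hm', rfl⟩ -
  obtain ⟨e, s, t, hS, rfl, h⟩ := Slice.joins_succ hm
  obtain rfl := Slice.joins_zero_cup h
  obtain ⟨e', he⟩ := Slice.joins_zero_cap hm'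
  obtain ⟨rfl, rfl, rfl⟩ : e = e' ∧ d = e'.rev ∧ d.rev :: s = m' := by simpa using he
  obtain ⟨⟨_, z⟩, S, rfl, rfl, rfl⟩ := List.map_eq_cons_iff.1 hS
  refine .of_subsingleton (subsingleton_cons ?_ fun M => ?_) (subsingleton_nil _ _) ?_
  · rintro M M' h₁ h₂ h₁' h₂'
    simp [Colored] at h₁ h₂ h₁' h₂'
    grind
  · exact subsingleton_of_no_cup (by simp) _ _
  · simp [Colored]

theorem locallyEquivalent_zagzig (d : Dir) :
    LocallyEquivalent A [⟨0, .cup d⟩, ⟨1, .cap⟩] [] := by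
  rintro S S' ⟨t, m, hm, m', hm', rfl⟩ -
  obtain rfl := Slice.joins_zero_cup hm
  obtain ⟨e, s, t, hS, rfl, h⟩ := Slice.joins_succ hm'
  obtain ⟨e', he⟩ := Slice.joins_zero_cap h
  obtain ⟨rfl, rfl⟩ := List.cons.inj hS
  obtain ⟨rfl, hS⟩ := List.cons.inj he
  rw [Dir.rev_rev] at hS
  obtain ⟨⟨_, z⟩, S, rfl, rfl, rfl⟩ := List.map_eq_cons_iff.1 hS
  refine .of_subsingleton (subsingleton_cons ?_ fun M => ?_) (subsingleton_nil _ _) ?_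
  · rintro M M' h₁ h₂ h₁' h₂'
    simp [Colored] at h₁ h₂ h₁' h₂'
    grind
  · exact subsingleton_of_no_cup (by simp) _ _
  · simp [Colored, eq_comm]

theorem locallyEquivalent_slideCap (k : Kind T) :
    LocallyEquivalent A [⟨0, .cross k⟩, ⟨1, .cap⟩] [⟨1, .cross k.flip⟩, ⟨0, .cap⟩] := by
  rintro S S' - -
  refine .of_subsingleton (subsingleton_of_no_cup (by simp) _ _)
    (subsingleton_of_no_cup (by simp) _ _) ?_
  rcases S with _ | ⟨⟨d, x⟩, _ | ⟨⟨e, y⟩, _ | ⟨⟨f, z⟩, S⟩⟩⟩ <;>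
    simp only [Colored, Slice.colors_one, Slice.colors_zero_cap, Slice.not_colors_cross_nil,
      Slice.not_colors_cross_singleton, Slice.colors_cross_cons_cons, List.cons.injEq,
      Prod.mk.injEq, ↓existsAndEq, and_true, true_and, and_false, false_and, exists_false,
      reduceCtorEq]
  have hf (g : Equiv.Perm Q) : z = e.rev.perm g x ↔ e.perm g z = x := by
    constructor <;> rintro rfl <;> simp
  cases k <;> simp only [Kind.left, Kind.right, Kind.flip, hf, eq_comm (b := S')] <;>
    constructor <;> rintro ⟨⟨rfl, rfl⟩, rfl⟩ <;> simp

theorem locallyEquivalent_slideCup (k : Kind T) (d : Dir) :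
    LocallyEquivalent A [⟨1, .cup d⟩, ⟨0, .cross k⟩] [⟨0, .cup d⟩, ⟨1, .cross k.flip⟩] := by
  rintro S S' - -
  refine .of_subsingleton (subsingleton_of_no_cap (by simp) _ _)
    (subsingleton_of_no_cap (by simp) _ _) ?_
  rcases S with _ | ⟨⟨f, z⟩, S⟩
  · simp [Colored]
  -- The color of the new arc on one side is the image of its color on the other side.
  have hf (g : Equiv.Perm Q) (P : Q → Q → Prop) :
      (∃ a, P (f.perm g a) a) ↔ ∃ a, P a (f.rev.perm g a) :=
    ⟨fun ⟨a, h⟩ => ⟨f.perm g a, by simpa using h⟩,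
      fun ⟨a, h⟩ => ⟨f.rev.perm g a, by simpa using h⟩⟩
  cases k <;> simp [Colored, Kind.left, Kind.right, Kind.flip]
  · exact hf _ fun a b => S' = (d, a) :: (f, z) :: (d.rev, b) :: S
  · exact hf _ fun a b => S' = (d, a) :: (f, d.rev.perm _ z) :: (d.rev, b) :: S

/-! ### Loops and the classical Reidemeister moves -/

/-- The color of the arc that a loop on the right adds to a strand of color `z` is unique, and the
loop does not change the color of the strand. -/
theorem Kind.exists_loop_right (k : Kind T) (d : Dir) (z : Q) :
    ∃ c, ∀ a b, k.right A d z a = a ∧ k.left A d z a = b ↔ a = c ∧ b = z := by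
  rcases k with _ | _ | α
  · refine ⟨z, fun a b => ?_⟩
    constructor
    · rintro ⟨h, rfl⟩
      obtain rfl : z = a := h
      simp [Kind.left]
    · rintro ⟨rfl, rfl⟩; simp [Kind.right, Kind.left]
  · refine ⟨z, fun a b => ?_⟩
    constructor
    · rintro ⟨h, rfl⟩
      have := congrArg (d.perm (Rack.act' a)) h
      simpa [Kind.right, Kind.left] using this.symm
    · rintro ⟨rfl, rfl⟩; simp [Kind.right, Kind.left]
  · refine ⟨d.rev.perm (A.op α) z, fun a b => ?_⟩
    constructor
    · rintro ⟨h, rfl⟩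
      obtain rfl : d.rev.perm (A.op α) z = a := h
      simp [Kind.left]
    · rintro ⟨rfl, rfl⟩; simp [Kind.right, Kind.left]

/-- The color of the arc that a loop on the left adds to a strand of color `z` is unique, and the
loop does not change the color of the strand. -/
theorem Kind.exists_loop_left (k : Kind T) (d : Dir) (z : Q) :
    ∃ c, ∀ a b, k.left A d a z = a ∧ k.right A d a z = b ↔ a = c ∧ b = z := by
  rcases k with _ | _ | α
  · refine ⟨z, fun a b => ?_⟩
    constructor
    · rintro ⟨h, rfl⟩
      have := congrArg (d.rev.perm (Rack.act' a)) h
      simpa [Kind.right, Kind.left, eq_comm] using this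
    · rintro ⟨rfl, rfl⟩; simp [Kind.right, Kind.left]
  · refine ⟨z, fun a b => ?_⟩
    constructor
    · rintro ⟨h, rfl⟩
      obtain rfl : z = a := h
      simp [Kind.right]
    · rintro ⟨rfl, rfl⟩; simp [Kind.right, Kind.left]
  · refine ⟨d.perm (A.op α) z, fun a b => ?_⟩
    constructor
    · rintro ⟨h, rfl⟩
      obtain rfl : d.perm (A.op α) z = a := h
      simp [Kind.right]
    · rintro ⟨rfl, rfl⟩; simp [Kind.right, Kind.left]

theorem locallyEquivalent_loop_right (k : Kind T) (d : Dir) :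
    LocallyEquivalent A [⟨1, .cup d⟩, ⟨0, .cross k⟩, ⟨1, .cap⟩] [] := by
  rintro S S' ⟨t, m, hm, m', hm', m'', hm'', rfl⟩ -
  obtain ⟨e, s, t, hS, rfl, h⟩ := Slice.joins_succ hm
  obtain rfl := Slice.joins_zero_cup h
  obtain ⟨_, _, _, h₁, rfl⟩ := Slice.joins_zero_cross hm'
  simp only [List.cons.injEq] at h₁
  obtain ⟨rfl, rfl, rfl⟩ := h₁
  obtain ⟨_, _, _, h₁, rfl, h₂⟩ := Slice.joins_succ hm''
  obtain ⟨rfl, rfl⟩ := List.cons.inj h₁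
  obtain ⟨_, he⟩ := Slice.joins_zero_cap h₂
  simp only [List.cons.injEq] at he
  obtain ⟨rfl, he, rfl⟩ := he
  obtain rfl : d = e := by simpa using congrArg Dir.rev he
  obtain ⟨⟨d, z⟩, S, rfl, rfl, rfl⟩ := List.map_eq_cons_iff.1 hS
  obtain ⟨c, hc⟩ := k.exists_loop_right (A := A) d z
  refine .of_subsingleton (subsingleton_cons ?_ fun M => ?_) (subsingleton_nil _ _) ?_
  · rintro M M' h₁ h₂ h₁' h₂'
    simp only [Slice.colors_one, Slice.colors_zero_cup, List.cons.injEq, ↓existsAndEq,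
      and_true, true_and] at h₁ h₁'
    obtain ⟨a, rfl⟩ := h₁
    obtain ⟨a', rfl⟩ := h₁'
    simp [Colored] at h₂ h₂'
    rw [((hc a _).1 ⟨h₂.1.symm, rfl⟩).1, ((hc a' _).1 ⟨h₂'.1.symm, rfl⟩).1]
  · exact subsingleton_of_no_cup (by simp) _ _
  · simp [Colored]
    constructor
    · rintro ⟨a, h₁, rfl⟩
      rw [((hc a _).1 ⟨h₁, rfl⟩).2]
    · rintro rfl
      obtain ⟨h₁, h₂⟩ := (hc c z).2 ⟨rfl, rfl⟩
      exact ⟨c, h₁, by rw [h₂]⟩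

theorem locallyEquivalent_loop_left (k : Kind T) (d : Dir) :
    LocallyEquivalent A [⟨0, .cup d⟩, ⟨1, .cross k⟩, ⟨0, .cap⟩] [] := by
  rintro S S' ⟨t, m, hm, m', hm', m'', hm'', rfl⟩ -
  obtain rfl := Slice.joins_zero_cup hm
  obtain ⟨_, _, _, h₁, rfl, h₂⟩ := Slice.joins_succ hm'
  obtain ⟨rfl, rfl⟩ := List.cons.inj h₁
  obtain ⟨_, e, _, h₁, rfl⟩ := Slice.joins_zero_cross h₂
  obtain ⟨rfl, hS⟩ := List.cons.inj h₁
  obtain ⟨_, he⟩ := Slice.joins_zero_cap hm''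
  simp only [List.cons.injEq] at he
  obtain ⟨rfl, rfl, rfl⟩ := he
  obtain ⟨⟨e, z⟩, S, rfl, he, rfl⟩ := List.map_eq_cons_iff.1 hS
  obtain rfl : e = d.rev := he
  obtain ⟨c, hc⟩ := k.exists_loop_left (A := A) d.rev z
  refine .of_subsingleton (subsingleton_cons ?_ fun M => ?_) (subsingleton_nil _ _) ?_
  · rintro M M' h₁ h₂ h₁' h₂'
    rw [Slice.colors_zero_cup] at h₁ h₁'
    obtain ⟨a, rfl⟩ := h₁
    obtain ⟨a', rfl⟩ := h₁'
    simp [Colored] at h₂ h₂'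
    rw [((hc a _).1 ⟨h₂.1, rfl⟩).1, ((hc a' _).1 ⟨h₂'.1, rfl⟩).1]
  · exact subsingleton_of_no_cup (by simp) _ _
  · simp [Colored]
    constructor
    · rintro ⟨a, h₁, rfl⟩
      rw [((hc a _).1 ⟨h₁.symm, rfl⟩).2]
    · rintro rfl
      obtain ⟨h₁, h₂⟩ := (hc c z).2 ⟨rfl, rfl⟩
      exact ⟨c, h₁.symm, by rw [h₂]⟩

theorem locallyEquivalent_reidemeister_two (k : Kind T) :
    LocallyEquivalent A [⟨0, .cross k⟩, ⟨0, .cross k.flip⟩] [] := by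
  rintro S S' ⟨t, m, hm, -⟩ -
  obtain ⟨d, e, r, hS, rfl⟩ := Slice.joins_zero_cross hm
  obtain ⟨⟨d, x⟩, _, rfl, rfl, hS'⟩ := List.map_eq_cons_iff.1 hS
  obtain ⟨⟨e, y⟩, S, rfl, rfl, rfl⟩ := List.map_eq_cons_iff.1 hS'
  refine .of_subsingleton (subsingleton_of_no_cap (by simp) _ _) (subsingleton_nil _ _) ?_
  cases k <;> simp [Colored, Kind.left, Kind.right, Kind.flip, eq_comm]

theorem locallyEquivalent_reidemeister_three (k₁ k₂ k₃ : Kind T)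
    (h₁ : k₁.IsClassical) (h₂ : k₂.IsClassical) (h₃ : k₃.IsClassical) (h : k₂ = k₁ ∨ k₂ = k₃) :
    LocallyEquivalent A [⟨0, .cross k₁⟩, ⟨1, .cross k₂⟩, ⟨0, .cross k₃⟩]
        [⟨1, .cross k₃⟩, ⟨0, .cross k₂⟩, ⟨1, .cross k₁⟩] := by
  rintro S S' - -
  refine .of_subsingleton (subsingleton_of_no_cap (by simp) _ _)
    (subsingleton_of_no_cap (by simp) _ _) ?_
  rcases S with _ | ⟨⟨d, x⟩, _ | ⟨⟨e, y⟩, _ | ⟨⟨f, z⟩, S⟩⟩⟩ <;>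
    simp [Colored]
  rcases k₁ <;> rcases k₂ <;> rcases k₃ <;> simp [Kind.IsClassical] at h₁ h₂ h₃ h <;>
    simp only [Kind.left, Kind.right]
  -- Self-distributivity is applied to the passage across the topmost of the three strands.
  · rw [Dir.perm_act_act d e x y z]
  · rw [Dir.perm_act_act d f.rev x z y]
  · rw [Dir.perm_act_act f.rev d z x y]
  · rw [Dir.perm_act_act e d y _ z, Dir.perm_rev_perm]
  · rw [Dir.perm_act_act e.rev f.rev y _ x, Dir.perm_perm_rev]
  · rw [Dir.perm_act_act f.rev e.rev z y x]

/-! ### The detour move across a single piece -/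

theorem sameColorings_passRight_cross (α : T) (k : Kind T) (S S' : List (Dir × Q)) :
    SameColorings A [⟨0, .cross (.virt α)⟩, ⟨1, .cross (.virt α)⟩, ⟨0, .cross k⟩]
      [⟨1, .cross k⟩, ⟨0, .cross (.virt α)⟩, ⟨1, .cross (.virt α)⟩] S S' := by
  refine .of_subsingleton (subsingleton_of_no_cap (by simp) _ _)
    (subsingleton_of_no_cap (by simp) _ _) ?_
  rcases S with _ | ⟨⟨d, x⟩, _ | ⟨⟨e, y⟩, _ | ⟨⟨f, z⟩, S⟩⟩⟩ <;>
    simp [Colored]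
  have h (e : Dir) (y z : Q) := d.perm_perm_act e (A.map_act α) y z
  have hc (d e : Dir) (β γ : T) (x : Q) := d.perm_comm e (A.comm β γ) x
  rcases k with _ | _ | β <;> simp only [Kind.left, Kind.right, h]
  · rw [hc f.rev e.rev α α x]
  · rw [hc f.rev e.rev α α x]
  · rw [hc f.rev e.rev α α x, hc d e α β z, hc d f.rev α β y]

theorem sameColorings_passLeft_cross (α : T) (k : Kind T) (S S' : List (Dir × Q)) :
    SameColorings A [⟨1, .cross (.virt α)⟩, ⟨0, .cross (.virt α)⟩, ⟨1, .cross k⟩]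
      [⟨0, .cross k⟩, ⟨1, .cross (.virt α)⟩, ⟨0, .cross (.virt α)⟩] S S' := by
  refine .of_subsingleton (subsingleton_of_no_cap (by simp) _ _)
    (subsingleton_of_no_cap (by simp) _ _) ?_
  rcases S with _ | ⟨⟨d, x⟩, _ | ⟨⟨e, y⟩, _ | ⟨⟨f, z⟩, S⟩⟩⟩ <;>
    simp [Colored]
  have h (e : Dir) (y z : Q) := f.rev.perm_perm_act e (A.map_act α) y z
  have hc (d e : Dir) (β γ : T) (x : Q) := d.perm_comm e (A.comm β γ) x
  rcases k with _ | _ | β <;> simp only [Kind.left, Kind.right, h]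
  · rw [hc d e α α z]
  · rw [hc d e α α z]
  · rw [hc d e α α z, hc f.rev d α β y, hc f.rev e.rev α β x]

theorem sameColorings_passRight_cup (α : T) (d : Dir) (a : Dir × Q) (S S' : List (Dir × Q)) :
    SameColorings A [⟨0, .cup d⟩]
      [⟨1, .cup d⟩, ⟨0, .cross (.virt α)⟩, ⟨1, .cross (.virt α)⟩] (a :: S) S' := by
  refine .of_subsingleton (subsingleton_of_no_cap (by simp) _ _)
    (subsingleton_of_no_cap (by simp) _ _) ?_
  obtain ⟨e, z⟩ := a
  simp [Colored, Kind.left, Kind.right]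
  -- The colors of the new arc before and after it crosses the passing strand correspond.
  exact (e.perm (A.op α)).surjective.exists

theorem sameColorings_passLeft_cup (α : T) (d : Dir) (a : Dir × Q) (S S' : List (Dir × Q)) :
    SameColorings A [⟨1, .cup d⟩]
      [⟨0, .cup d⟩, ⟨1, .cross (.virt α)⟩, ⟨0, .cross (.virt α)⟩] (a :: S) S' := by
  refine .of_subsingleton (subsingleton_of_no_cap (by simp) _ _)
    (subsingleton_of_no_cap (by simp) _ _) ?_
  obtain ⟨e, z⟩ := a
  simp [Colored, Kind.left, Kind.right]
  exact (e.rev.perm (A.op α)).surjective.exists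

theorem sameColorings_passRight_cap (α : T) (S S' : List (Dir × Q)) :
    SameColorings A [⟨0, .cross (.virt α)⟩, ⟨1, .cross (.virt α)⟩, ⟨0, .cap⟩] [⟨1, .cap⟩] S S' := by
  refine .of_subsingleton (subsingleton_of_no_cup (by simp) _ _)
    (subsingleton_of_no_cup (by simp) _ _) ?_
  rcases S with _ | ⟨⟨d, x⟩, _ | ⟨⟨e, y⟩, _ | ⟨⟨f, z⟩, S⟩⟩⟩ <;>
    simp [Colored, Kind.left, Kind.right]
  constructor
  · rintro ⟨⟨rfl, rfl⟩, rfl⟩; simp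
  · rintro ⟨rfl, rfl, rfl⟩; simp

/-- The condition on `S` provides the passing strand, which starts to the right of the maximum. -/
theorem sameColorings_passLeft_cap (α : T) (a : Dir × Q) (S S' : List (Dir × Q))
    (hS : 2 ≤ S.length) :
    SameColorings A [⟨1, .cross (.virt α)⟩, ⟨0, .cross (.virt α)⟩, ⟨1, .cap⟩] [⟨0, .cap⟩]
      (a :: S) S' := by
  refine .of_subsingleton (subsingleton_of_no_cup (by simp) _ _)
    (subsingleton_of_no_cup (by simp) _ _) ?_
  obtain ⟨d, x⟩ := a
  rcases S with _ | ⟨⟨e, y⟩, _ | ⟨⟨f, z⟩, S⟩⟩ <;>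
    simp [Colored, Kind.left, Kind.right] at hS ⊢
  constructor
  · rintro ⟨⟨rfl, rfl⟩, rfl⟩; simp
  · rintro ⟨⟨rfl, rfl⟩, rfl⟩; simp

/-! ### The detour move across a tangle -/

theorem passRight_eq_shift (α : T) (i m : ℕ) : passRight α i m = shift i (passRight α 0 m) := by
  simp [passRight, shift, Function.comp_def]

theorem passLeft_eq_shift (α : T) (i m : ℕ) : passLeft α i m = shift i (passLeft α 0 m) := by
  rw [passLeft, passRight_eq_shift, passLeft, shift, shift, List.map_reverse]

theorem passRight_add (α : T) (m n : ℕ) :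
    passRight α 0 (m + n) = passRight α 0 m ++ shift m (passRight α 0 n) := by
  simp [passRight, shift, List.range_add, Function.comp_def]

theorem passLeft_add (α : T) (m n : ℕ) :
    passLeft α 0 (m + n) = shift m (passLeft α 0 n) ++ passLeft α 0 m := by
  rw [passLeft, passRight_add, List.reverse_append, passLeft, passLeft, shift, shift,
    List.map_reverse]

/-- A piece and a tangle diagram to its right exchange heights. -/
theorem sameColorings_exchange_shift (p : Piece T) (w : List (Slice T)) (S S' : List (Dir × Q)) :
    SameColorings A (⟨0, p⟩ :: shift p.numTop w) (shift p.numBottom w ++ [⟨0, p⟩]) S S' := by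
  induction w generalizing S with
  | nil => exact .refl _ _ _
  | cons x w ih =>
    exact (SameColorings.append_right (shift p.numTop w) fun M =>
      sameColorings_exchange p x.piece x.pos S M).trans (.cons _ fun M _ => ih M)

theorem Slice.Joins.length {x : Slice T} {s t : List Dir} (h : x.Joins s t) :
    ∃ r, s.length = x.pos + (x.piece.numBottom + r) ∧ t.length = x.pos + (x.piece.numTop + r) := by
  cases h with
  | cup l r d => exact ⟨r.length, by simp [Piece.numBottom], by simp [Piece.numTop]; omega⟩
  | cap l r d => exact ⟨r.length, by simp [Piece.numBottom]; omega, by simp [Piece.numTop]⟩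
  | cross l r k d e =>
    exact ⟨r.length, by simp [Piece.numBottom]; omega, by simp [Piece.numTop]; omega⟩

theorem Slice.Colors.length {x : Slice T} {S S' : List (Dir × Q)} (h : x.Colors A S S') :
    S.length + x.piece.numTop = S'.length + x.piece.numBottom := by
  obtain ⟨r, h₁, h₂⟩ := h.joins.length
  simp only [List.length_map] at h₁ h₂
  omega

theorem Colored.length_eq_of_passLeft {α : T} {i m : ℕ} {S S' : List (Dir × Q)}
    (h : Colored A (passLeft α i m) S S') : S'.length = S.length := by
  have hw : ∀ x ∈ passLeft α i m, x.piece.numTop = x.piece.numBottom := by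
    simp [passLeft, passRight, Piece.numTop, Piece.numBottom]
  generalize passLeft α i m = w at h hw
  induction w generalizing S with
  | nil => exact congrArg _ (Eq.symm h)
  | cons x w ih =>
    rw [List.forall_mem_cons] at hw
    obtain ⟨M, hM, h⟩ := h
    have := hM.length
    rw [ih h hw.2]
    omega

/-- The detour move to the right across a slice with a single piece. -/
theorem sameColorings_passRight_slice (α : T) (p : Piece T) (k r : ℕ) (S S' : List (Dir × Q))
    (hS : k + (p.numBottom + r) < S.length) :
    SameColorings A (passRight α 0 (k + (p.numBottom + r)) ++ [⟨k, p⟩])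
      (⟨1 + k, p⟩ :: passRight α 0 (k + (p.numTop + r))) S S' := by
  induction k generalizing S S' with
  | zero =>
    rw [Nat.zero_add, Nat.zero_add, passRight_add, passRight_add, List.append_assoc]
    refine .trans (.append_left _ fun M _ => (sameColorings_exchange_shift p _ M S').symm) ?_
    rw [← List.singleton_append, ← List.append_assoc, ← List.cons_append]
    refine .append_right _ fun M => ?_
    obtain ⟨a, S, rfl⟩ := List.exists_cons_of_length_pos (Nat.zero_lt_of_lt hS)
    cases p with
    | cup d => exact sameColorings_passRight_cup α d a S M
    | cap => exact sameColorings_passRight_cap α _ M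
    | cross k => exact sameColorings_passRight_cross α k _ M
  | succ k ih =>
    rw [Nat.add_comm k 1, Nat.add_assoc, Nat.add_assoc, passRight_add α 1,
      passRight_add α 1, List.append_assoc]
    -- Once the strand has passed one vertical strand, both lie to the left of the remaining part.
    have h₁ : SameColorings A
        (passRight α 0 1 ++ shift 1 (passRight α 0 (k + (p.numBottom + r)) ++ [⟨k, p⟩]))
        (passRight α 0 1 ++ shift 1 (⟨1 + k, p⟩ :: passRight α 0 (k + (p.numTop + r)))) S S' := by
      refine .append_left _ ?_
      rintro M ⟨_, hM, rfl⟩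
      rcases S with _ | ⟨⟨d, x⟩, _ | ⟨⟨e, y⟩, S⟩⟩
      · simp at hS
      · simp at hS
      · obtain rfl := Slice.colors_cross_cons_cons.1 hM
        exact .shift_one fun S' => ih _ S' (by simp at hS ⊢; omega)
    rw [shift_append] at h₁
    refine h₁.trans ?_
    have h₂ (M) : SameColorings A [⟨0, .cross (.virt α)⟩, ⟨1 + (1 + k), p⟩]
        [⟨1 + (1 + k), p⟩, ⟨0, .cross (.virt α)⟩] S M := by
      have := sameColorings_exchange (A := A) (.cross (.virt α)) p k S M
      rwa [Piece.numTop, Piece.numBottom, show 2 + k = 1 + (1 + k) by omega] at this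
    exact SameColorings.append_right (shift 1 (passRight α 0 (k + (p.numTop + r)))) h₂

/-- The detour move to the left across a slice with a single piece. -/
theorem sameColorings_passLeft_slice (α : T) (p : Piece T) (k r : ℕ) (S S' : List (Dir × Q))
    (hS : k + (p.numBottom + r) < S.length) :
    SameColorings A (passLeft α 0 (k + (p.numBottom + r)) ++ [⟨1 + k, p⟩])
      (⟨k, p⟩ :: passLeft α 0 (k + (p.numTop + r))) S S' := by
  induction k generalizing S S' with
  | zero =>
    rw [Nat.zero_add, Nat.zero_add, passLeft_add, passLeft_add, List.append_assoc]
    have h₁ : SameColorings A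
        (shift p.numBottom (passLeft α 0 r) ++ (passLeft α 0 p.numBottom ++ [⟨1 + 0, p⟩]))
        (shift p.numBottom (passLeft α 0 r) ++ (⟨0, p⟩ :: passLeft α 0 p.numTop)) S S' := by
      refine .append_left _ fun M hM => ?_
      have hM' : p.numBottom < M.length := by
        rw [← passLeft_eq_shift] at hM
        rw [hM.length_eq_of_passLeft]
        omega
      obtain ⟨a, M, rfl⟩ := List.exists_cons_of_length_pos (Nat.zero_lt_of_lt hM')
      cases p with
      | cup d => exact sameColorings_passLeft_cup α d a M S'
      | cap => exact sameColorings_passLeft_cap α a M S' (Nat.lt_succ_iff.1 hM')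
      | cross k => exact sameColorings_passLeft_cross α k _ S'
    refine h₁.trans ?_
    rw [List.append_cons, ← List.cons_append]
    exact .append_right _ fun M => (sameColorings_exchange_shift p _ S M).symm
  | succ k ih =>
    rw [Nat.add_comm k 1, Nat.add_assoc, Nat.add_assoc, passLeft_add α 1,
      passLeft_add α 1, List.append_assoc]
    have h₁ (M) : SameColorings A
        (shift 1 (passLeft α 0 (k + (p.numBottom + r)) ++ [⟨1 + k, p⟩]))
        (shift 1 (⟨k, p⟩ :: passLeft α 0 (k + (p.numTop + r)))) S M := by
      obtain ⟨a, S, rfl⟩ := List.exists_cons_of_length_pos (Nat.zero_lt_of_lt hS)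
      exact .shift_one fun S' => ih _ S' (by simp at hS ⊢; omega)
    rw [shift_append] at h₁
    refine .trans ?_ (.append_right (passLeft α 0 1) h₁)
    rw [List.append_assoc]
    refine .append_left _ fun M _ => ?_
    have := sameColorings_exchange (A := A) (.cross (.virt α)) p k M S'
    simpa [Piece.numTop, Piece.numBottom, passLeft, passRight, shift, Nat.add_assoc,
        show 1 + (1 + k) = 2 + k by omega] using this

/-- The detour move to the right across a tangle, slice by slice. The condition on `S` says that there
is a passing strand besides the lower ends of the tangle. -/
theorem sameColorings_passRight (α : T) (w : List (Slice T)) (s t : List Dir) (hw : Joins w s t)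
    (S S' : List (Dir × Q)) (hS : s.length < S.length) :
    SameColorings A (passRight α 0 s.length ++ w) (shift 1 w ++ passRight α 0 t.length) S S' := by
  induction w generalizing s S with
  | nil => obtain rfl := hw; rw [List.append_nil]; exact .refl _ _ _
  | cons x w ih =>
    obtain ⟨m, hm, hw⟩ := hw
    obtain ⟨r, h₁, h₂⟩ := hm.length
    rw [List.append_cons, h₁]
    refine .trans (.append_right w fun M =>
      sameColorings_passRight_slice α x.piece x.pos r S M (h₁ ▸ hS)) ?_
    refine .cons _ fun M hM => ?_
    have : S.length + x.piece.numTop = M.length + x.piece.numBottom := hM.length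
    rw [← h₂]
    exact ih m hw M (by omega)

/-- The detour move to the left across a tangle, slice by slice. The condition on `S` says that there
is a passing strand besides the lower ends of the tangle. -/
theorem sameColorings_passLeft (α : T) (w : List (Slice T)) (s t : List Dir) (hw : Joins w s t)
    (S S' : List (Dir × Q)) (hS : s.length < S.length) :
    SameColorings A (passLeft α 0 s.length ++ shift 1 w) (w ++ passLeft α 0 t.length) S S' := by
  induction w generalizing s S with
  | nil => obtain rfl := hw; rw [shift, List.map_nil, List.append_nil]; exact .refl _ _ _
  | cons x w ih =>
    obtain ⟨m, hm, hw⟩ := hw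
    obtain ⟨r, h₁, h₂⟩ := hm.length
    rw [shift, List.map_cons, List.append_cons, h₁]
    refine .trans (.append_right _ fun M =>
      sameColorings_passLeft_slice α x.piece x.pos r S M (h₁ ▸ hS)) ?_
    refine .cons _ fun M hM => ?_
    have : S.length + x.piece.numTop = M.length + x.piece.numBottom := hM.length
    rw [← h₂]
    exact ih m hw M (by omega)

/-- All strands that a strand passes to its right are present at the lower boundary. -/
theorem Joins.le_of_passRight {α : T} {n : ℕ} {d : Dir} {s t : List Dir}
    (h : Joins (passRight α 0 n) (d :: s) t) : n ≤ s.length := by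
  induction n generalizing s t with
  | zero => exact Nat.zero_le _
  | succ n ih =>
    rw [Nat.add_comm, passRight_add] at h
    obtain ⟨m, hm, h⟩ := h
    obtain ⟨_, e, r, hs, rfl⟩ := Slice.joins_zero_cross hm
    obtain ⟨rfl, rfl⟩ := List.cons.inj hs
    obtain ⟨_, h⟩ := h.of_shift_one
    simpa using ih h

theorem locallyEquivalent_detour_right (α : T) (w : List (Slice T)) (s t : List Dir)
    (hw : Joins w s t) :
    LocallyEquivalent A (passRight α 0 s.length ++ w) (shift 1 w ++ passRight α 0 t.length) := by
  rintro S S' ⟨t₁, ha⟩ ⟨t₂, hb⟩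
  -- The passing strand may be missing only if both sides are empty.
  by_cases hw' : w = []
  · subst hw'
    obtain rfl := hw
    rw [List.append_nil]
    exact .refl _ _ _
  obtain ⟨_, ha, -⟩ := joins_append ha
  obtain ⟨_, hb, -⟩ := joins_append hb
  rcases S with _ | ⟨a, S⟩
  · exact absurd (hb.shift_eq_nil one_pos) hw'
  · exact sameColorings_passRight α w s t hw _ S'
      (Nat.lt_succ_of_le (by simpa using ha.le_of_passRight))

theorem locallyEquivalent_detour_left (α : T) (w : List (Slice T)) (s t : List Dir)
    (hw : Joins w s t) :
    LocallyEquivalent A (passLeft α 0 s.length ++ shift 1 w) (w ++ passLeft α 0 t.length) := by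
  rintro S S' ⟨t₁, ha⟩ -
  by_cases hw' : w = []
  · subst hw'
    obtain rfl := hw
    rw [shift, List.map_nil, List.append_nil]
    exact .refl _ _ _
  refine sameColorings_passLeft α w s t hw S S' ?_
  generalize s.length = n at ha
  cases n with
  | zero =>
    rcases S with _ | ⟨a, S⟩
    · exact absurd (Joins.shift_eq_nil one_pos ha) hw'
    · exact Nat.succ_pos _
  | succ n =>
    -- The first crossing is the rightmost one.
    rw [passLeft_add] at ha
    obtain ⟨m, hm, -⟩ := ha
    obtain ⟨r, hr, -⟩ := hm.length
    simp [Piece.numBottom] at hr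
    omega

/-! ### Invariance under all moves -/

theorem locallyEquivalent_of_isotopy {a b : List (Slice T)} (h : Isotopy a b) :
    LocallyEquivalent A a b := by
  cases h with
  | exchange i k p q =>
    have : LocallyEquivalent A [⟨0, p⟩, ⟨p.numTop + k, q⟩] [⟨p.numBottom + k, q⟩, ⟨0, p⟩] :=
      fun S S' _ _ => sameColorings_exchange p q k S S'
    simpa [MultiVirtual.shift, Nat.add_assoc] using this.shift i
  | zigzag i d => exact (locallyEquivalent_zigzag d).shift i
  | zagzig i d => exact (locallyEquivalent_zagzig d).shift i
  | slideCap i k => exact (locallyEquivalent_slideCap k).shift i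
  | slideCup i k d => exact (locallyEquivalent_slideCup k d).shift i

theorem locallyEquivalent_of_loop {k : Kind T} {w : List (Slice T)} (h : Loop k w) :
    LocallyEquivalent A w [] := by
  cases h with
  | right i d => exact (locallyEquivalent_loop_right k d).shift i
  | left i d => exact (locallyEquivalent_loop_left k d).shift i

theorem locallyEquivalent_of_reidemeister {a b : List (Slice T)} (h : Reidemeister a b) :
    LocallyEquivalent A a b := by
  cases h with
  | one k hk _ hw => exact locallyEquivalent_of_loop hw
  | two i k hk => exact (locallyEquivalent_reidemeister_two k).shift i
  | three i k₁ k₂ k₃ h₁ h₂ h₃ h =>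
    exact (locallyEquivalent_reidemeister_three k₁ k₂ k₃ h₁ h₂ h₃ h).shift i

theorem locallyEquivalent_of_detour {a b : List (Slice T)} (h : Detour a b) :
    LocallyEquivalent A a b := by
  cases h with
  | right α i w s t hw =>
    have := (locallyEquivalent_detour_right (A := A) α w s t hw).shift i
    rwa [shift_append, shift_append, shift_shift, ← passRight_eq_shift, ← passRight_eq_shift] at this
  | left α i w s t hw =>
    have := (locallyEquivalent_detour_left (A := A) α w s t hw).shift i
    rwa [shift_append, shift_append, shift_shift, ← passLeft_eq_shift, ← passLeft_eq_shift] at this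
  | loop α _ hw => exact locallyEquivalent_of_loop hw

theorem Move.numColorings_eq {D₁ D₂ : Diagram T} (h : Move D₁ D₂) :
    D₁.numColorings A = D₂.numColorings A := by
  obtain ⟨w, a, b, z, h₁, h₂, h | h | h⟩ := h
  · exact Diagram.numColorings_eq_of_locallyEquivalent h₁ h₂ (locallyEquivalent_of_isotopy h)
  · exact Diagram.numColorings_eq_of_locallyEquivalent h₁ h₂ (locallyEquivalent_of_reidemeister h)
  · exact Diagram.numColorings_eq_of_locallyEquivalent h₁ h₂ (locallyEquivalent_of_detour h)

end MultiVirtual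

theorem theorem4p1 {T : Type*} {Q : Type*} [Quandle Q] (A : MultiVirtual.OperatorQuandle T Q)
    (D₁ D₂ : MultiVirtual.Diagram T) (h : MultiVirtual.Equivalent D₁ D₂) :
    D₁.numColorings A = D₂.numColorings A := by
  induction h with
  | rel _ _ h => exact h.numColorings_eq
  | refl => rfl
  | symm _ _ _ ih => exact ih.symm
  | trans _ _ _ _ _ ih₁ ih₂ => exact ih₁.trans ih₂
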